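/- **Setting.** For $n\ge 1$ let $G_n$ be the oriented toroidal $n\times n$ grid with node set $V_n=(\mathbb Z/n)^2$, in which $(x,y)$ has the east neighbour $(x+1,y)$ and the north neighbour $(x,y+1)$. The radius-$t$ neighbourhood of a node $v$ in a labelling of $V_n$ is the function which maps every offset $(a,b)\in\mathbb Z^2$ with $|a|+|b|\le t$ to the label of $v+(a,b)$. An LCL problem $P$ is given by a finite non-empty set $X$ of output labels, a radius $r$ and a set of allowed $X$-labelled radius-$r$ neighbourhoods; a labelling $f\colon V_n\to X$ is feasible if the radius-$r$ neighbourhood of every node is allowed. The nodes have unique identifiers from $\{1,\dots,N(n)\}$, where $N$ is a fixed function with $N(n)\ge n^2$ and $N(n)=n^{O(1)}$. An algorithm with running time $T$ is a deterministic LOCAL algorithm: on $G_n$ the output of a node is a function of $n$ and of its radius-$T(n)$ neighbourhood in the labelling by identifiers. It solves $P$ if, for all sufficiently large $n$ and every assignment of identifiers, its output on $G_n$ is feasible. $G^{(k)}$ is the $k$-th power of a graph $G$ (distinct nodes at distance at most $k$ are adjacent), and $\log^* n$ is the iterated binary logarithm. **Theorem 5.1.** There is an absolute constant $C$ such that for every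 $N$ as above there are algorithms $S_k$ ($k\ge 0$), which do not depend on any LCL problem, such that $S_k$ has running time $O(\log^* n)$ and, for all sufficiently large $n$ and every assignment of identifiers, outputs a maximal independent set of $G_n^{(k)}$, given as a $\{0,1\}$-labelling; moreover, the following hold for every LCL problem $P$. 1. (Speed-up and normal form.) Suppose that some algorithm solves $P$ in time $T(n)=o(n)$. Then there are $k\ge 1$, $R\le Ck$ and a function $A'$ from the $\{0,1\}$-labelled radius-$R$ neighbourhoods to $X$ such that, for all sufficiently large $n$ and every maximal independent set $I$ of $G_n^{(k)}$ (the set of anchors), the labelling that assigns to every node the value of $A'$ on its radius-$R$ neighbourhood in the indicator labelling of $I$ is feasible. In particular, the algorithm $B=A'\circ S_k$ (run $S_k$, then apply $A'$ to the radius-$R$ neighbourhoods of its output) solves $P$ and has running time $O(\log^* n)$. 2. (Classification.) The complexity of $P$ is $O(1)$, $\Theta(\log^* n)$ or $\Theta(n)$. That is, at least one of the following holds: * (trivial) some algorithm solves $P$ in time $O(1)$; * (local) some algorithm solves $P$ in time $O(\log^* n)$, and there is $c>0$ such that, for all sufficiently large $n$, every algorithm whose outputs on $G_n$ are feasible for all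 assignments of identifiers has running time at least $c\log^* n$ on $G_n$; * (global) some algorithm with running time $O(n)$ has, for all sufficiently large $n$ for which a feasible labelling of $G_n$ exists, feasible outputs on $G_n$ for all assignments of identifiers, and there is $c>0$ such that, for all sufficiently large $n$, every algorithm whose outputs on $G_n$ are feasible for all assignments of identifiers has running time at least $cn$ on $G_n$. -/

import Mathlib

open Filter Asymptotics

namespace GridLCL

/-! ### Oriented toroidal grids -/

/-- The node set of the `n × n` torus (coordinates modulo `n`, used for `n ≥ 1`). The first
coordinate increases towards the east, the second one towards the north. -/
abbrev Torus (n : ℕ) : Type := ZMod n × ZMod n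

/-- The `n × n` toroidal grid: `u` and `v` are adjacent if and only if one of them is the
east or the north neighbour of the other one. -/
def grid (n : ℕ) : SimpleGraph (Torus n) :=
  SimpleGraph.fromRel fun u v => v = (u.1 + 1, u.2) ∨ v = (u.1, u.2 + 1)

/-- The `k`-th power of a graph: distinct nodes are adjacent if and only if their distance in `G`
is at most `k` (`edist` is `⊤` between different components). -/
def power {V : Type*} (G : SimpleGraph V) (k : ℕ) : SimpleGraph V where
  Adj u v := u ≠ v ∧ G.edist u v ≤ k
  symm := ⟨fun u v h => ⟨h.1.symm, by rw [SimpleGraph.edist_comm]; exact h.2⟩⟩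
  loopless := ⟨fun _ h => h.1 rfl⟩

/-- The nodes labelled `true` (the "anchors") form a maximal independent set in the `k`-th power
of the `n × n` toroidal grid. -/
def IsAnchorSet (n k : ℕ) (I : Torus n → Bool) : Prop :=
  Maximal (power (grid n) k).IsIndepSet {v | I v = true}

/-- The radius-`t` ball of offsets `(a, b)`: `a` steps to the east and `b` steps to the north,
with `|a| + |b| ≤ t`. -/
abbrev Ball (t : ℕ) : Type := {p : ℤ × ℤ // |p.1| + |p.2| ≤ (t : ℤ)}

/-- The node reached from `v` by the offset `p`. -/
def shift {n : ℕ} (v : Torus n) (p : ℤ × ℤ) : Torus n :=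
  (v.1 + (p.1 : ZMod n), v.2 + (p.2 : ZMod n))

/-- The oriented radius-`t` neighbourhood of the node `v` in the torus labelled by `f`: it records,
for every way to walk at most `t` steps away from `v`, the label of the node reached. For
`n > 2 t` this is the labelled subgraph formed by the nodes within distance `t` of `v`. -/
def view {n : ℕ} {Y : Type*} (t : ℕ) (f : Torus n → Y) (v : Torus n) : Ball t → Y :=
  fun p => f (shift v p.1)

/-! ### Locally checkable labelling problems -/

/-- A locally checkable labelling problem with output labels `X` on oriented grids: a
checkability radius `r` and the collection of allowed (oriented) labelled radius-`r`
neighbourhoods. -/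
structure LCL (X : Type*) where
  /-- the checkability radius -/
  r : ℕ
  /-- the allowed radius-`r` neighbourhoods -/
  allowed : Set (Ball r → X)

/-- `f` is a feasible solution of `P` on the `n × n` torus: all radius-`r` neighbourhoods are
allowed. -/
def LCL.Feasible {X : Type*} (P : LCL X) {n : ℕ} (f : Torus n → X) : Prop :=
  ∀ v, view P.r f v ∈ P.allowed

/-! ### The LOCAL model -/

/-- `N n` is the largest identifier that may occur in the `n × n` grid. There are at least as many
identifiers as nodes, and at most polynomially many. -/
def IsIdRange (N : ℕ → ℕ) : Prop :=
  (∀ n, n ^ 2 ≤ N n) ∧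
    ∃ d : ℕ, (fun n => (N n : ℝ)) =O[atTop] (fun n : ℕ => (n : ℝ) ^ d)

/-- An assignment of unique identifiers from `{1, …, M}` to the nodes of the `n × n` torus. -/
def IsIdAssignment {n : ℕ} (M : ℕ) (ident : Torus n → ℕ) : Prop :=
  Function.Injective ident ∧ ∀ v, ident v ∈ Set.Icc 1 M

/-- A deterministic LOCAL algorithm on oriented toroidal grids. All nodes know `n`; on the
`n × n` torus the algorithm runs for `time n` rounds, and the output of a node is a function of its
radius-`time n` neighbourhood with the identifiers in it. -/
structure LocalAlgorithm (X : Type*) where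
  /-- the number of communication rounds on the `n × n` torus -/
  time : ℕ → ℕ
  /-- the local output -/
  out : ∀ n : ℕ, (Ball (time n) → ℕ) → X

/-- The labelling of the torus that the algorithm outputs for the given identifiers. -/
def LocalAlgorithm.run {X : Type*} (A : LocalAlgorithm X) {n : ℕ} (ident : Torus n → ℕ) :
    Torus n → X :=
  fun v => A.out n (view (A.time n) ident v)

/-- `A` solves `P` on the `n × n` torus, for all identifiers from `{1, …, N n}`. -/
def LocalAlgorithm.SolvesOn {X : Type*} (A : LocalAlgorithm X) (P : LCL X) (N : ℕ → ℕ) (n : ℕ) :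
    Prop :=
  ∀ ident : Torus n → ℕ, IsIdAssignment (N n) ident → P.Feasible (A.run ident)

/-- `A` solves `P`: it solves `P` on the `n × n` torus for all sufficiently large `n`. -/
def LocalAlgorithm.Solves {X : Type*} (A : LocalAlgorithm X) (P : LCL X) (N : ℕ → ℕ) : Prop :=
  ∀ᶠ n in atTop, A.SolvesOn P N n

/-- The running time of `A` is `O(g)`. -/
def LocalAlgorithm.TimeBigO {X : Type*} (A : LocalAlgorithm X) (g : ℕ → ℝ) : Prop :=
  (fun n => (A.time n : ℝ)) =O[atTop] g

/-- The running time of `A` is `o(g)`. -/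
def LocalAlgorithm.TimeLittleO {X : Type*} (A : LocalAlgorithm X) (g : ℕ → ℝ) : Prop :=
  (fun n => (A.time n : ℝ)) =o[atTop] g

theorem ball_add {s t : ℕ} (p : Ball s) (q : Ball t) :
    |(p.1 + q.1).1| + |(p.1 + q.1).2| ≤ ((s + t : ℕ) : ℤ) := by
  have h1 := abs_add_le p.1.1 q.1.1
  have h2 := abs_add_le p.1.2 q.1.2
  have h3 := p.2
  have h4 := q.2
  push_cast
  simp only [Prod.fst_add, Prod.snd_add]
  linarith

/-- The composition `F ∘ S`: first run `S`, then apply the function `F` to the radius-`R`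
neighbourhoods of the labelling that `S` outputs, which takes `R` further rounds. -/
def LocalAlgorithm.postcomp {X Y : Type*} {R : ℕ} (F : (Ball R → Y) → X) (S : LocalAlgorithm Y) :
    LocalAlgorithm X where
  time n := R + S.time n
  out n w := F fun p => S.out n fun q => w ⟨p.1 + q.1, ball_add p q⟩

/-- The labelling that `F ∘ S` outputs is `F` applied to the labelling that `S` outputs. -/
theorem LocalAlgorithm.run_postcomp {X Y : Type*} {R : ℕ} (F : (Ball R → Y) → X)
    (S : LocalAlgorithm Y) {n : ℕ} (ident : Torus n → ℕ) (v : Torus n) :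
    (LocalAlgorithm.postcomp F S).run ident v = F (view R (S.run ident) v) := by
  simp only [LocalAlgorithm.run, LocalAlgorithm.postcomp]
  congr 1
  funext p
  simp only [view, LocalAlgorithm.run]
  congr 1
  funext q
  simp [view, shift, add_assoc]

/-! ### Complexity classes -/

/-- The iterated logarithm: the least number of times that the binary logarithm has to be applied
to `n` until the result is at most `1`. -/
noncomputable def logStar (n : ℕ) : ℕ :=
  sInf {k : ℕ | (Real.logb 2)^[k] (n : ℝ) ≤ 1}

/-- `P` can be solved in `O(g)` rounds. -/
def LCL.ComplexityBigO {X : Type*} (P : LCL X) (N : ℕ → ℕ) (g : ℕ → ℝ) : Prop :=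
  ∃ A : LocalAlgorithm X, A.Solves P N ∧ A.TimeBigO g

/-- `P` requires `Ω(g)` rounds: for some `c > 0` and all sufficiently large `n`, every
algorithm that solves `P` on the `n × n` torus uses at least `c * g n` rounds there. -/
def LCL.ComplexityOmega {X : Type*} (P : LCL X) (N : ℕ → ℕ) (g : ℕ → ℝ) : Prop :=
  ∃ c : ℝ, 0 < c ∧ ∀ᶠ n in atTop, ∀ A : LocalAlgorithm X,
    A.SolvesOn P N n → c * g n ≤ (A.time n : ℝ)

/-- Trivial problems: complexity `O(1)`. -/
def LCL.IsTrivial {X : Type*} (P : LCL X) (N : ℕ → ℕ) : Prop :=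
  P.ComplexityBigO N fun _ => 1

/-- Local problems: complexity `Θ(log* n)`. -/
def LCL.IsLocal {X : Type*} (P : LCL X) (N : ℕ → ℕ) : Prop :=
  P.ComplexityBigO N (fun n => (logStar n : ℝ)) ∧
    P.ComplexityOmega N (fun n => (logStar n : ℝ))

/-- Global problems: complexity `Θ(n)`. Problems without solutions for infinitely many `n` are
allowed here, and only here; the bounds then refer to those `n` for which a solution exists. -/
def LCL.IsGlobal {X : Type*} (P : LCL X) (N : ℕ → ℕ) : Prop :=
  (∃ A : LocalAlgorithm X, A.TimeBigO (fun n => (n : ℝ)) ∧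
      ∀ᶠ n in atTop, (∃ f : Torus n → X, P.Feasible f) → A.SolvesOn P N n) ∧
    P.ComplexityOmega N (fun n => (n : ℝ))

end GridLCL

open GridLCL

/-!
The theorem rests on three constructions that use nothing but the geometry of the torus.

*Anchors.* For a fixed nonzero offset `p`, the steps `v ↦ v + p` split the torus into cycles, and
Cole–Vishkin colour reduction along them (`reduceColor`) turns the identifiers into constantly many
colours in `log* n` rounds (`exists_reduceColor_bound`). The tuple of the colours for all offsets in
the ball of radius `k` is a proper colouring of the `k`-th power of the grid, and a greedy pass
through the colour classes gives a maximal independent set (`exists_anchor_algorithm`).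

*Normal form.* Given a set of anchors in the `k`-th power, every node has an anchor within
distance `k`, and its offset to such an anchor is an identifier that is unique within distance `k`,
since different anchors are more than `k` apart. There are at most `n ^ 2` of these identifiers if
`2 * k < n`. Hence an algorithm that solves `P` on *one* sufficiently large torus, of side length `n` and in
less than `n / 8` rounds, can be run with these local identifiers on all large tori: what it does near a node
also occurs on the `n × n` torus with honest identifiers (`LocalAlgorithm.SolvesOn.mem_allowed`,
`exists_normalForm`). So a problem either has the normal form, and is solved in `O(log* n)` rounds,
or it needs at least `n / 8` rounds on all large tori. In the latter case, gathering the whole torus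
is optimal (`exists_global_algorithm`).

*Gap below `log* n`.* If some constant labelling is feasible, then `P` is trivial. Otherwise give
the node in column `i` and row `j` of a patch the identifier `n * c i + d j + 1`, with increasing
`c` and `d`. The output of an algorithm with running time `t` depends on windows of length about
`2 * t` in `c` and `d`. Unless `n` is below a tower of height `4 * t + O(1)`, the classical bound for shift
graphs (`le_iterate_of_forall_ne`), used once in each coordinate, provides `c` and `d` for which the
output is constant on a ball of the checkability radius
(`exists_monochromatic_window_pairs`, `exists_logStar_le`).
-/

namespace GridLCL

/-! ### Towers and the iterated logarithm -/

/-- The tower of twos of height `j`. -/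
def tower : ℕ → ℕ
  | 0 => 1
  | j + 1 => 2 ^ tower j

theorem tower_pos (j : ℕ) : 1 ≤ tower j := by
  cases j with
  | zero => exact le_rfl
  | succ j => exact Nat.one_le_two_pow

theorem tower_lt_succ (j : ℕ) : tower j < tower (j + 1) := Nat.lt_two_pow_self

theorem tower_mono : Monotone tower := monotone_nat_of_le_succ fun j => (tower_lt_succ j).le

theorem lt_tower (j : ℕ) : j < tower j := by
  induction j with
  | zero => exact Nat.one_pos
  | succ j ih => exact (Nat.succ_le_of_lt ih).trans_lt (tower_lt_succ j)

theorem iterate_two_pow_tower (j a : ℕ) : (fun x => 2 ^ x)^[j] (tower a) = tower (a + j) := by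
  induction j with
  | zero => rfl
  | succ j ih => rw [Function.iterate_succ_apply', ih]; rfl

theorem iterate_two_pow_le {j x a : ℕ} (h : x ≤ tower a) :
    (fun x => 2 ^ x)^[j] x ≤ tower (a + j) := by
  rw [← iterate_two_pow_tower]
  exact (Monotone.iterate (fun a b hab => Nat.pow_le_pow_right two_pos hab) j) h

theorem mul_le_tower {x y a : ℕ} (hx : x ≤ tower a) (hy : y ≤ tower a) :
    x * y ≤ tower (a + 2) := by
  have h2 : tower a + tower a ≤ 2 ^ tower a := by
    have h1 : tower a - 1 < 2 ^ (tower a - 1) := Nat.lt_two_pow_self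
    have h3 := tower_pos a
    have h4 : 2 ^ tower a = 2 * 2 ^ (tower a - 1) := by
      rw [← pow_succ', Nat.sub_add_cancel h3]
    omega
  calc x * y ≤ 2 ^ tower a * 2 ^ tower a :=
        Nat.mul_le_mul (hx.trans Nat.lt_two_pow_self.le) (hy.trans Nat.lt_two_pow_self.le)
    _ = 2 ^ (tower a + tower a) := (pow_add _ _ _).symm
    _ ≤ 2 ^ 2 ^ tower a := Nat.pow_le_pow_right two_pos h2
    _ = tower (a + 2) := rfl

theorem pow_le_tower {x y a : ℕ} (hx : x ≤ tower a) (hy : y ≤ tower a) :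
    x ^ y ≤ tower (a + 3) :=
  calc x ^ y ≤ (2 ^ x) ^ y := Nat.pow_le_pow_left Nat.lt_two_pow_self.le y
    _ = 2 ^ (x * y) := (pow_mul _ _ _).symm
    _ ≤ 2 ^ tower (a + 2) := Nat.pow_le_pow_right two_pos (mul_le_tower hx hy)
    _ = tower (a + 3) := rfl

/-- The `j`-th iterate itself need not be at most `1`: iterates after the first one that is at most
`1` may be negative, and `Real.logb 2 x` is the logarithm of `|x|` then. -/
theorem exists_iterate_logb_le (j : ℕ) (x : ℝ) (hx : x ≤ tower j) :
    ∃ i ≤ j, (Real.logb 2)^[i] x ≤ 1 := by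
  induction j generalizing x with
  | zero => exact ⟨0, le_rfl, by simpa [tower] using hx⟩
  | succ j ih =>
    by_cases h1 : x ≤ 1
    · exact ⟨0, Nat.zero_le _, by simpa using h1⟩
    · obtain ⟨i, hi, h⟩ := ih (Real.logb 2 x) (by
        rw [Real.logb_le_iff_le_rpow one_lt_two (by linarith)]
        simpa [tower] using hx)
      exact ⟨i + 1, by omega, by simpa [Function.iterate_succ_apply] using h⟩

theorem logStar_le_of_le_tower {n j : ℕ} (h : n ≤ tower j) : logStar n ≤ j := by
  obtain ⟨i, hi, h1⟩ := exists_iterate_logb_le j n (by exact_mod_cast h)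
  exact (Nat.sInf_le h1).trans hi

theorem le_tower_of_iterate_logb (j : ℕ) (x : ℝ) (h : (Real.logb 2)^[j] x ≤ 1)
    (h' : ∀ i < j, 1 < (Real.logb 2)^[i] x) : x ≤ tower j := by
  induction j generalizing x with
  | zero => simpa [tower] using h
  | succ j ih =>
    have h0 : 1 < x := by simpa using h' 0 (Nat.succ_pos j)
    have h1 := ih (Real.logb 2 x) (by simpa [Function.iterate_succ_apply] using h) fun i hi => by
      simpa [Function.iterate_succ_apply] using h' (i + 1) (by omega)
    rw [Real.logb_le_iff_le_rpow one_lt_two (by linarith)] at h1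
    simpa [tower] using h1

theorem le_tower_logStar (n : ℕ) : n ≤ tower (logStar n) := by
  have hne : {k : ℕ | (Real.logb 2)^[k] (n : ℝ) ≤ 1}.Nonempty := by
    obtain ⟨i, -, hi⟩ := exists_iterate_logb_le n n (by exact_mod_cast (lt_tower n).le)
    exact ⟨i, hi⟩
  have h := le_tower_of_iterate_logb (logStar n) n (Nat.sInf_mem hne) fun i hi =>
    not_le.1 (Nat.notMem_of_lt_sInf hi)
  exact_mod_cast h

theorem tendsto_logStar : Tendsto logStar atTop atTop := by
  refine tendsto_atTop.2 fun b => ?_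
  filter_upwards [eventually_gt_atTop (tower b)] with n hn
  by_contra h
  exact absurd ((le_tower_logStar n).trans (tower_mono (not_le.1 h).le)) (not_le.2 hn)

/-! ### Offsets and distances in the torus -/

section Torus

variable {n : ℕ}

theorem shift_shift (v : Torus n) (p q : ℤ × ℤ) : shift (shift v p) q = shift v (p + q) := by
  simp [shift, add_assoc]

@[simp] theorem shift_zero (v : Torus n) : shift v 0 = v := by simp [shift]

theorem shift_neg_eq {u v : Torus n} {p : ℤ × ℤ} (h : v = shift u p) : u = shift v (-p) := by
  rw [h, shift_shift, add_neg_cancel, shift_zero]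

/-- Offsets that differ by less than `n` steps lead to different nodes. -/
theorem shift_left_injective {v : Torus n} {p q : ℤ × ℤ}
    (h : |(p - q).1| + |(p - q).2| < (n : ℤ)) (e : shift v p = shift v q) : p = q := by
  have key : ∀ a b : ℤ, |a - b| < (n : ℤ) → (a : ZMod n) = b → a = b := by
    intro a b hab he
    rw [← sub_eq_zero, ← Int.cast_sub, ZMod.intCast_zmod_eq_zero_iff_dvd] at he
    exact sub_eq_zero.1 (Int.eq_zero_of_abs_lt_dvd he hab)
  simp only [shift, Prod.mk.injEq, add_right_inj] at e
  simp only [Prod.fst_sub, Prod.snd_sub] at h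
  have h1 := abs_nonneg (p.1 - q.1)
  have h2 := abs_nonneg (p.2 - q.2)
  exact Prod.ext (key _ _ (by linarith) e.1) (key _ _ (by linarith) e.2)

theorem ball_sub {s t : ℕ} {p q : ℤ × ℤ} (hp : |p.1| + |p.2| ≤ (s : ℤ))
    (hq : |q.1| + |q.2| ≤ (t : ℤ)) : |(p - q).1| + |(p - q).2| ≤ ((s + t : ℕ) : ℤ) := by
  have h1 := abs_sub p.1 q.1
  have h2 := abs_sub p.2 q.2
  push_cast
  simp only [Prod.fst_sub, Prod.snd_sub]
  linarith

instance (t : ℕ) : Finite (Ball t) := by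
  refine Set.Finite.subset (Set.finite_Icc ((-t : ℤ), (-t : ℤ)) ((t : ℤ), (t : ℤ))) ?_
  intro p (hp : |p.1| + |p.2| ≤ (t : ℤ))
  have h1 := abs_nonneg p.1
  have h2 := abs_nonneg p.2
  have h3 := abs_le.1 (show |p.1| ≤ (t : ℤ) by linarith)
  have h4 := abs_le.1 (show |p.2| ≤ (t : ℤ) by linarith)
  exact ⟨⟨h3.1, h4.1⟩, ⟨h3.2, h4.2⟩⟩

/-- Walking along an offset takes at most `|a| + |b|` steps, also for `n = 1`, where the unit steps
are loops. -/
theorem edist_shift_natAbs_le (u : Torus n) (p : ℤ × ℤ) :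
    (grid n).edist u (shift u p) ≤ (p.1.natAbs + p.2.natAbs : ℕ) := by
  have one : ∀ (u v : Torus n), (v = (u.1 + 1, u.2) ∨ v = (u.1, u.2 + 1)) →
      (grid n).edist u v ≤ 1 := by
    intro u v h
    by_cases huv : u = v
    · simp [huv]
    · exact (SimpleGraph.edist_eq_one_iff_adj.2
        ((SimpleGraph.fromRel_adj _ _ _).2 ⟨huv, Or.inl h⟩)).le
  have step : ∀ (e : ℤ × ℤ), (∀ u : Torus n, (grid n).edist u (shift u e) ≤ 1) →
      ∀ (m : ℕ) (u : Torus n), (grid n).edist u (shift u (m • e)) ≤ m := by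
    intro e he m
    induction m with
    | zero => intro u; simp
    | succ m ih =>
      intro u
      rw [succ_nsmul, ← shift_shift]
      refine (SimpleGraph.edist_triangle (v := shift u (m • e))).trans ?_
      push_cast
      exact add_le_add (ih u) (he _)
  have steps : ∀ (e : ℤ × ℤ), (∀ u : Torus n, (grid n).edist u (shift u e) ≤ 1) →
      ∀ (a : ℤ) (u : Torus n), (grid n).edist u (shift u (a • e)) ≤ a.natAbs := by
    intro e he a u
    obtain ⟨m, rfl | rfl⟩ := a.eq_nat_or_neg
    · simpa only [natCast_zsmul, Int.natAbs_natCast] using step e he m u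
    · have := step e he m (shift u (-(m : ℤ) • e))
      rw [shift_shift, ← natCast_zsmul, ← add_smul, neg_add_cancel, zero_smul, shift_zero,
        SimpleGraph.edist_comm] at this
      simpa only [Int.natAbs_neg, Int.natAbs_natCast] using this
  have h1 := steps (1, 0) (fun u => one _ _ (Or.inl (by simp [shift]))) p.1 u
  have h2 := steps (0, 1) (fun u => one _ _ (Or.inr (by simp [shift]))) p.2
    (shift u (p.1 • (1, 0)))
  rw [shift_shift, show p.1 • ((1, 0) : ℤ × ℤ) + p.2 • ((0, 1) : ℤ × ℤ) = p by ext <;> simp] at h2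
  refine (SimpleGraph.edist_triangle (v := shift u (p.1 • (1, 0)))).trans ?_
  push_cast
  exact add_le_add h1 h2

theorem exists_shift_of_walk {u v : Torus n} (w : (grid n).Walk u v) :
    ∃ p : ℤ × ℤ, |p.1| + |p.2| ≤ (w.length : ℤ) ∧ v = shift u p := by
  induction w with
  | nil => exact ⟨0, by simp, by simp⟩
  | @cons a b c h w ih =>
    obtain ⟨p, hp, rfl⟩ := ih
    obtain ⟨e, he, rfl⟩ : ∃ e : ℤ × ℤ, |e.1| + |e.2| ≤ 1 ∧ b = shift a e := by
      obtain ⟨-, (h | h) | (h | h)⟩ := (SimpleGraph.fromRel_adj _ _ _).1 h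
      · exact ⟨(1, 0), by simp, by simp [h, shift]⟩
      · exact ⟨(0, 1), by simp, by simp [h, shift]⟩
      · exact ⟨(-1, 0), by simp, by simp [h, shift]⟩
      · exact ⟨(0, -1), by simp, by simp [h, shift]⟩
    refine ⟨e + p, ?_, shift_shift _ _ _⟩
    have := ball_add (s := 1) (t := w.length) ⟨e, by simpa using he⟩ ⟨p, hp⟩
    rw [SimpleGraph.Walk.length_cons, add_comm w.length]
    exact this

/-- The nodes at distance at most `k` from `u` are the ones reached by offsets in the ball of
radius `k`. -/
theorem edist_le_iff {u v : Torus n} {k : ℕ} :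
    (grid n).edist u v ≤ k ↔ ∃ p : Ball k, v = shift u p.1 := by
  constructor
  · intro h
    obtain ⟨w, hw⟩ := SimpleGraph.exists_walk_of_edist_ne_top
      (ne_top_of_le_ne_top (ENat.natCast_ne_top k) h)
    obtain ⟨p, hp, rfl⟩ := exists_shift_of_walk w
    have : w.length ≤ k := by rw [← hw] at h; exact_mod_cast h
    exact ⟨⟨p, hp.trans (by exact_mod_cast this)⟩, rfl⟩
  · rintro ⟨p, rfl⟩
    refine (edist_shift_natAbs_le u p.1).trans ?_
    have := p.2
    have h : p.1.1.natAbs + p.1.2.natAbs ≤ k := by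
      have h1 : ((p.1.1.natAbs + p.1.2.natAbs : ℕ) : ℤ) = |p.1.1| + |p.1.2| := by
        push_cast; simp
      omega
    exact_mod_cast h

theorem power_grid_adj {u v : Torus n} {k : ℕ} :
    (power (grid n) k).Adj u v ↔ u ≠ v ∧ ∃ p : Ball k, v = shift u p.1 :=
  and_congr Iff.rfl edist_le_iff

theorem IsAnchorSet.eq_of_shift {k : ℕ} {I : Torus n → Bool} (hI : IsAnchorSet n k I)
    {u : Torus n} {p : Ball k} (hu : I u = true) (hv : I (shift u p.1) = true) :
    u = shift u p.1 := by
  by_contra h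
  exact hI.1 hu hv h (power_grid_adj.2 ⟨h, p, rfl⟩)

/-- Every node has an anchor within distance `k`. -/
theorem IsAnchorSet.exists_anchor {k : ℕ} {I : Torus n → Bool} (hI : IsAnchorSet n k I)
    (v : Torus n) : ∃ p : Ball k, I (shift v p.1) = true := by
  by_contra! h
  have hv : v ∈ {v | I v = true} := by
    refine hI.2 (y := insert v {v | I v = true}) ?_ (Set.subset_insert _ _) (Set.mem_insert _ _)
    refine Set.pairwise_insert.2 ⟨hI.1, fun u hu _ => ?_⟩
    have hadj : ¬ (power (grid n) k).Adj v u := by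
      intro hadj
      obtain ⟨-, p, rfl⟩ := power_grid_adj.1 hadj
      exact h p hu
    exact ⟨hadj, fun hadj' => hadj hadj'.symm⟩
  exact h ⟨0, by simp⟩ (by simpa using hv)

theorem isAnchorSet_of_forall {k : ℕ} {I : Torus n → Bool}
    (h1 : ∀ (u : Torus n) (p : Ball k), I u = true → I (shift u p.1) = true → u = shift u p.1)
    (h2 : ∀ v, I v = false → ∃ p : Ball k, I (shift v p.1) = true) : IsAnchorSet n k I := by
  refine ⟨?_, ?_⟩
  · intro u hu v hv huv hadj
    obtain ⟨-, p, rfl⟩ := power_grid_adj.1 hadj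
    exact huv (h1 u p hu hv)
  · intro s hs hIs v hv
    by_contra hvI
    obtain ⟨p, hp⟩ := h2 v (by simpa using hvI)
    have hne : v ≠ shift v p.1 := fun h => hvI (by rw [h]; exact hp)
    exact hs hv (hIs hp) hne (power_grid_adj.2 ⟨hne, p, rfl⟩)

end Torus

/-! ### Local transformations of labellings -/

section Local

variable {n : ℕ} {Y Z W : Type*}

/-- A map between labellings of the torus is `t`-local if the new label of a node depends only on
the radius-`t` neighbourhood of the node. The two nodes compared may be different, so a local map
commutes with translations. -/
def IsLocal (t : ℕ) (Φ : (Torus n → Y) → Torus n → Z) : Prop :=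
  ∀ f g v w, view t f v = view t g w → Φ f v = Φ g w

theorem view_eq_iff {t : ℕ} {f g : Torus n → Y} {v w : Torus n} :
    view t f v = view t g w ↔ ∀ p : Ball t, f (shift v p.1) = g (shift w p.1) :=
  funext_iff

theorem IsLocal.comp {s t : ℕ} {Ψ : (Torus n → Z) → Torus n → W} {Φ : (Torus n → Y) → Torus n → Z}
    (hΨ : IsLocal s Ψ) (hΦ : IsLocal t Φ) : IsLocal (s + t) fun f => Ψ (Φ f) := by
  intro f g v w h
  refine hΨ _ _ _ _ (view_eq_iff.2 fun p => hΦ _ _ _ _ (view_eq_iff.2 fun q => ?_))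
  rw [shift_shift, shift_shift]
  exact view_eq_iff.1 h ⟨p.1 + q.1, ball_add p q⟩

theorem IsLocal.iterate {t : ℕ} {Φ : (Torus n → Y) → Torus n → Y} (hΦ : IsLocal t Φ) (j : ℕ) :
    IsLocal (j * t) Φ^[j] := by
  induction j with
  | zero =>
    intro f g v w h
    simpa using view_eq_iff.1 h ⟨0, by simp⟩
  | succ j ih =>
    rw [Function.iterate_succ, Nat.succ_mul]
    exact ih.comp hΦ

/-- Local maps, one for each size of the torus, are computed by a local algorithm. -/
theorem exists_algorithm [Nonempty Z] (time : ℕ → ℕ) (Φ : ∀ n, (Torus n → ℕ) → Torus n → Z)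
    (h : ∀ n, IsLocal (time n) (Φ n)) :
    ∃ A : LocalAlgorithm Z, A.time = time ∧
      ∀ n (ident : Torus n → ℕ), A.run ident = Φ n ident := by
  classical
  refine ⟨⟨time, fun n w => if hw : ∃ fv : (Torus n → ℕ) × Torus n, view (time n) fv.1 fv.2 = w
    then Φ n hw.choose.1 hw.choose.2 else Classical.arbitrary Z⟩, rfl, fun n ident => ?_⟩
  funext v
  have hw : ∃ fv : (Torus n → ℕ) × Torus n, view (time n) fv.1 fv.2 = view (time n) ident v :=
    ⟨(ident, v), rfl⟩
  simp only [LocalAlgorithm.run]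
  rw [dif_pos hw]
  exact h n _ _ _ _ hw.choose_spec

end Local

/-! ### Colour reduction -/

section Color

variable {n : ℕ}

open Classical in
/-- The Cole–Vishkin colour of a node of colour `x` whose successor has colour `y`: the position of
the lowest bit in which `x` and `y` differ, together with that bit of `x`. -/
noncomputable def bitColor (x y : ℕ) : ℕ :=
  if h : ∃ i, x.testBit i ≠ y.testBit i then 2 * Nat.find h + (x.testBit (Nat.find h)).toNat else 0

theorem exists_testBit_ne {x y : ℕ} (h : x ≠ y) : ∃ i, x.testBit i ≠ y.testBit i := by
  by_contra! h'
  exact h (Nat.eq_of_testBit_eq h')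

theorem bitColor_lt {x y b : ℕ} (hx : x < 2 ^ b) (hy : y < 2 ^ b) (h : x ≠ y) :
    bitColor x y < 2 * b := by
  classical
  have h' := exists_testBit_ne h
  rw [bitColor, dif_pos h']
  have hlt : Nat.find h' < b := by
    by_contra hb
    have hb : 2 ^ b ≤ 2 ^ Nat.find h' := Nat.pow_le_pow_right two_pos (not_lt.1 hb)
    exact Nat.find_spec h' (by
      rw [Nat.testBit_lt_two_pow (hx.trans_le hb), Nat.testBit_lt_two_pow (hy.trans_le hb)])
  have := Bool.toNat_le (x.testBit (Nat.find h'))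
  omega

/-- If the position in the new colours agrees, then the bits there differ by the choice of the
position. -/
theorem bitColor_ne {x y z : ℕ} (h : x ≠ y) (h' : y ≠ z) : bitColor x y ≠ bitColor y z := by
  classical
  have hx := exists_testBit_ne h
  have hy := exists_testBit_ne h'
  rw [bitColor, bitColor, dif_pos hx, dif_pos hy]
  intro e
  have h1 := Bool.toNat_le (x.testBit (Nat.find hx))
  have h2 := Bool.toNat_le (y.testBit (Nat.find hy))
  have e1 : Nat.find hx = Nat.find hy := by omega
  have e2 : (x.testBit (Nat.find hx)).toNat = (y.testBit (Nat.find hy)).toNat := by omega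
  rw [← e1] at e2
  exact Nat.find_spec hx (by simpa using congrArg (· == 1) e2)

/-- One round of Cole–Vishkin colour reduction on the cycles formed by the steps `v ↦ v + p`. -/
noncomputable def reduceColor (p : ℤ × ℤ) (f : Torus n → ℕ) (v : Torus n) : ℕ :=
  bitColor (f v) (f (shift v p))

theorem isLocal_reduceColor {k : ℕ} (p : Ball k) : IsLocal k (reduceColor (n := n) p.1) := by
  intro f g v w h
  have h0 := view_eq_iff.1 h ⟨0, by simp⟩
  simp only [shift_zero] at h0
  rw [reduceColor, reduceColor, h0, view_eq_iff.1 h p]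

theorem iterate_reduceColor_ne {p : ℤ × ℤ} {f : Torus n → ℕ} (h : ∀ v, f v ≠ f (shift v p))
    (j : ℕ) (v : Torus n) :
    (reduceColor p)^[j] f v ≠ (reduceColor p)^[j] f (shift v p) := by
  induction j generalizing v with
  | zero => exact h v
  | succ j ih =>
    rw [Function.iterate_succ_apply']
    exact bitColor_ne (ih v) (ih _)

/-- A round takes the logarithm of the number of colours, up to a constant factor, so it lowers the
height of a tower by one. -/
theorem iterate_reduceColor_lt {p : ℤ × ℤ} {f : Torus n → ℕ} (h : ∀ v, f v ≠ f (shift v p))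
    {s a j : ℕ} (hs : 3 ≤ s) (hf : ∀ v, f v < 2 ^ s * (tower (a + j) + 1)) (v : Torus n) :
    (reduceColor p)^[j] f v < 2 ^ s * (tower a + 1) := by
  induction j generalizing f with
  | zero => exact hf v
  | succ j ih =>
    rw [Function.iterate_succ_apply]
    refine ih (fun v => iterate_reduceColor_ne h 1 v) fun v => ?_
    have hT := tower_pos (a + (j + 1))
    have hb : ∀ v, f v < 2 ^ (s + 1 + tower (a + j)) := fun v => by
      refine (hf v).trans_le ?_
      calc 2 ^ s * (tower (a + (j + 1)) + 1) ≤ 2 ^ s * (2 * tower (a + (j + 1))) :=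
            Nat.mul_le_mul_left _ (by omega)
        _ = 2 ^ s * (2 * 2 ^ tower (a + j)) := rfl
        _ = 2 ^ (s + 1 + tower (a + j)) := by ring
    refine (bitColor_lt (hb v) (hb _) (h v)).trans_le ?_
    have h2s : 2 * (s + 1) ≤ 2 ^ s := by
      clear ih hf hb
      induction s, hs using Nat.le_induction with
      | base => norm_num
      | succ s hs ih => rw [pow_succ]; omega
    calc 2 * (s + 1 + tower (a + j)) ≤ 2 * (s + 1) * (tower (a + j) + 1) := by
          have := Nat.zero_le (s * tower (a + j)); nlinarith
      _ ≤ 2 ^ s * (tower (a + j) + 1) := Nat.mul_le_mul_right _ h2s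

theorem IsIdRange.exists_lt {N : ℕ → ℕ} (hN : IsIdRange N) :
    ∃ e d : ℕ, ∀ᶠ n in atTop, N n < 2 ^ e * n ^ d := by
  obtain ⟨-, d, hd⟩ := hN
  obtain ⟨c, hc⟩ := hd.bound
  obtain ⟨e, he⟩ := pow_unbounded_of_one_lt c (one_lt_two (α := ℝ))
  refine ⟨e, d, ?_⟩
  filter_upwards [hc, eventually_ge_atTop 1] with n hn h1
  have hpos : (0 : ℝ) < (n : ℝ) ^ d := pow_pos (by exact_mod_cast h1) d
  rw [Real.norm_of_nonneg (Nat.cast_nonneg _), Real.norm_of_nonneg hpos.le] at hn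
  have : (N n : ℝ) < 2 ^ e * (n : ℝ) ^ d := hn.trans_lt (mul_lt_mul_of_pos_right he hpos)
  exact_mod_cast this

/-- Polynomially many colours are reduced to constantly many in `log* n` rounds. -/
theorem exists_reduceColor_bound {N : ℕ → ℕ} (hN : IsIdRange N) :
    ∃ Q : ℕ, 0 < Q ∧ ∀ᶠ n in atTop, ∀ ident : Torus n → ℕ, IsIdAssignment (N n) ident →
      ∀ p : ℤ × ℤ, (∀ v : Torus n, v ≠ shift v p) →
        ∀ v, (reduceColor p)^[logStar n] ident v < Q := by
  obtain ⟨e, d, hed⟩ := hN.exists_lt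
  set s := 2 * (e + d) + 3 with hs
  refine ⟨2 ^ s * (tower 0 + 1), by positivity, ?_⟩
  filter_upwards [hed, tendsto_logStar.eventually_ge_atTop 1] with n hn h1 ident hid p hp v
  obtain ⟨j, hj⟩ : ∃ j, logStar n = j + 1 := ⟨logStar n - 1, by omega⟩
  have hne : ∀ v, ident v ≠ ident (shift v p) := fun v h => hp v (hid.1 h)
  -- The first round turns polynomially many colours into `O(log n)` many.
  rw [hj, Function.iterate_succ_apply]
  refine iterate_reduceColor_lt (fun v => iterate_reduceColor_ne hne 1 v) (by omega) (fun v => ?_) v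
  have hb : ∀ v, ident v < 2 ^ (e + d * tower j) := fun v => by
    calc ident v ≤ N n := (hid.2 v).2
      _ < 2 ^ e * n ^ d := hn
      _ ≤ 2 ^ e * (2 ^ tower j) ^ d := by
          have := le_tower_logStar n
          rw [hj] at this
          exact Nat.mul_le_mul_left _ (Nat.pow_le_pow_left this d)
      _ = 2 ^ (e + d * tower j) := by rw [← pow_mul, ← pow_add, mul_comm d]
  refine (bitColor_lt (hb v) (hb _) (hne v)).trans_le ?_
  rw [zero_add]
  calc 2 * (e + d * tower j) ≤ s * (tower j + 1) := by
        rw [hs]; nlinarith [Nat.zero_le (e * tower j), Nat.zero_le (tower j)]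
    _ ≤ 2 ^ s * (tower j + 1) := Nat.mul_le_mul_right _ Nat.lt_two_pow_self.le

/-! ### Greedy maximal independent sets -/

/-- The nodes of colour `i` enter the set unless it already contains a node within distance `k`. -/
noncomputable def greedyStep (k i : ℕ) (f : Torus n → ℕ × Bool) (v : Torus n) : ℕ × Bool :=
  open Classical in
  ((f v).1, (f v).2 || decide ((f v).1 = i ∧ ∀ p : Ball k, (f (shift v p.1)).2 = false))

/-- The greedy algorithm goes through the colours `0, …, i - 1`. -/
noncomputable def greedy (k : ℕ) : ℕ → (Torus n → ℕ × Bool) → Torus n → ℕ × Bool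
  | 0, f => f
  | i + 1, f => greedyStep k i (greedy k i f)

theorem isLocal_greedyStep (k i : ℕ) : IsLocal k (greedyStep (n := n) k i) := by
  intro f g v w h
  have h0 := view_eq_iff.1 h ⟨0, by simp⟩
  simp only [shift_zero] at h0
  rw [greedyStep, greedyStep, h0]
  refine congrArg _ (congrArg _ (decide_eq_decide.2 ?_))
  simp only [view_eq_iff.1 h]

theorem isLocal_greedy (k i : ℕ) : IsLocal (i * k) (greedy (n := n) k i) := by
  induction i with
  | zero =>
    intro f g v w h
    simpa [greedy] using view_eq_iff.1 h ⟨0, by simp⟩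
  | succ i ih =>
    rw [Nat.succ_mul, add_comm]
    exact (isLocal_greedyStep k i).comp ih

theorem greedyStep_snd {k i : ℕ} {f : Torus n → ℕ × Bool} {v : Torus n} :
    (greedyStep k i f v).2 = true ↔
      (f v).2 = true ∨ (f v).1 = i ∧ ∀ p : Ball k, (f (shift v p.1)).2 = false := by
  simp [greedyStep]

theorem greedy_fst (k i : ℕ) (f : Torus n → ℕ × Bool) (v : Torus n) :
    (greedy k i f v).1 = (f v).1 := by
  induction i with
  | zero => rfl
  | succ i ih => exact ih

/-- The greedy algorithm applied to a proper colouring of the `k`-th power gives a maximal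
independent set. -/
theorem isAnchorSet_greedy {k K : ℕ} {c : Torus n → ℕ} (hK : ∀ v, c v < K)
    (hc : ∀ v (p : Ball k), v ≠ shift v p.1 → c v ≠ c (shift v p.1)) :
    IsAnchorSet n k fun v => (greedy k K (fun v => (c v, false)) v).2 := by
  set f : Torus n → ℕ × Bool := fun v => (c v, false)
  refine isAnchorSet_of_forall ?_ fun v hv => ?_
  · clear hK
    induction K with
    | zero => intro u p hu; simp [greedy, f] at hu
    | succ i ih =>
      intro u p hu hv
      rw [greedy, greedyStep_snd, greedy_fst] at hu hv
      rcases hu with hu | ⟨hu, hu'⟩ <;> rcases hv with hv | ⟨hv, hv'⟩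
      · exact ih u p hu hv
      · have := hv' ⟨-p.1, by simpa using p.2⟩
        rw [← shift_neg_eq rfl, hu] at this
        cases this
      · rw [hu' p] at hv
        cases hv
      · by_contra h
        exact hc u p h (hu.trans hv.symm)
  · have key : ∀ i, c v < i → (greedy k i f v).2 = true ∨
        ∃ p : Ball k, (greedy k i f (shift v p.1)).2 = true := by
      intro i
      induction i with
      | zero => intro h; omega
      | succ i ih =>
        intro hi
        simp only [greedy, greedyStep_snd]
        by_cases h : ∃ p : Ball k, (greedy k i f (shift v p.1)).2 = true
        · obtain ⟨p, hp⟩ := h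
          exact Or.inr ⟨p, Or.inl hp⟩
        · rcases Nat.lt_succ_iff_lt_or_eq.1 hi with hi | hi
          · rcases ih hi with h' | h'
            · exact Or.inl (Or.inl h')
            · exact absurd h' h
          · refine Or.inl (Or.inr ⟨by rw [greedy_fst]; exact hi, fun p => ?_⟩)
            by_contra hp
            exact h ⟨p, by simpa using hp⟩
    rcases key K (hK v) with h | h
    · rw [hv] at h
      cases h
    · exact h

/-- Translations without fixed points are the nontrivial ones. -/
theorem ne_shift_iff {p : ℤ × ℤ} {v : Torus n} :
    v ≠ shift v p ↔ ((p.1 : ZMod n), (p.2 : ZMod n)) ≠ 0 := by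
  simp [shift, Prod.ext_iff]

/-- Maximal independent sets in the `k`-th power of the grid are found in `O(log* n)` rounds: the
colours obtained by colour reduction along all offsets in the ball of radius `k` form together a
proper colouring of the `k`-th power with constantly many colours. -/
theorem exists_anchor_algorithm {N : ℕ → ℕ} (hN : IsIdRange N) (k : ℕ) :
    ∃ S : LocalAlgorithm Bool, S.TimeBigO (fun n => (logStar n : ℝ)) ∧
      ∀ᶠ n in atTop, ∀ ident : Torus n → ℕ, IsIdAssignment (N n) ident →
        IsAnchorSet n k (S.run ident) := by
  obtain ⟨Q, hQ, hbound⟩ := exists_reduceColor_bound hN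
  have : NeZero Q := ⟨hQ.ne'⟩
  obtain ⟨K, ⟨code⟩⟩ := Finite.exists_equiv_fin (Ball k → Fin Q)
  let color : ∀ n, (Torus n → ℕ) → Torus n → ℕ × Bool := fun n ident v =>
    (code fun p => Fin.ofNat Q ((reduceColor p.1)^[logStar n] ident v), false)
  have hcolor : ∀ n, IsLocal (logStar n * k) (color n) := by
    intro n f g v w h
    have : ∀ p : Ball k, (reduceColor p.1)^[logStar n] f v = (reduceColor p.1)^[logStar n] g w :=
      fun p => (isLocal_reduceColor p).iterate (logStar n) _ _ _ _ h
    simp only [color, this]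
  obtain ⟨S, hS, hrun⟩ := exists_algorithm (fun n => K * k + logStar n * k)
    (fun n ident v => (greedy k K (color n ident) v).2) fun n f g v w h =>
      congrArg Prod.snd (((isLocal_greedy k K).comp (hcolor n)) f g v w h)
  refine ⟨S, ?_, ?_⟩
  · refine IsBigO.of_bound (K * k + k : ℝ) ?_
    filter_upwards [tendsto_logStar.eventually_ge_atTop 1] with n hn
    have h1 : (1 : ℝ) ≤ logStar n := by exact_mod_cast hn
    have h2 : (0 : ℝ) ≤ (K : ℝ) * k := by positivity
    rw [hS, Real.norm_of_nonneg (Nat.cast_nonneg _), Real.norm_of_nonneg (Nat.cast_nonneg _)]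
    push_cast
    nlinarith
  · filter_upwards [hbound] with n hn ident hid
    rw [hrun]
    refine isAnchorSet_greedy (fun v => (code _).2) fun v p hp e => ?_
    have e := congrFun (code.injective (Fin.ext e)) p
    have hp' : ∀ v : Torus n, v ≠ shift v p.1 := fun w => ne_shift_iff.2 (ne_shift_iff.1 hp)
    have e := congrArg Fin.val e
    simp only [Fin.val_ofNat, Nat.mod_eq_of_lt (hn ident hid p.1 hp' _)] at e
    exact iterate_reduceColor_ne (fun v h => hp' v (hid.1 h)) _ v e

end Color

/-! ### Simulation with locally unique identifiers -/

section Simulation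

variable {n : ℕ} {X : Type*}

/-- Distinct identifiers on a small ball extend to an assignment on the whole torus. -/
theorem exists_identAssignment {m M : ℕ} (hm : 2 * m < n) (hM : n ^ 2 ≤ M) {h : ℤ × ℤ → ℕ}
    (hinj : ∀ p q : Ball m, h p.1 = h q.1 → p = q) (hr : ∀ p : Ball m, h p.1 ∈ Set.Icc 1 (n ^ 2)) :
    ∃ ident : Torus n → ℕ, IsIdAssignment M ident ∧
      ∀ p : Ball m, ident (shift 0 p.1) = h p.1 := by
  classical
  have : NeZero n := ⟨by omega⟩
  have hsh : Function.Injective fun p : Ball m => shift (0 : Torus n) p.1 := fun p q e =>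
    Subtype.ext (shift_left_injective ((ball_sub p.2 q.2).trans_lt (by push_cast; omega)) e)
  let f : Torus n → ℕ := Function.extend (fun p : Ball m => shift 0 p.1) (fun p => h p.1) 1
  have hf : ∀ p : Ball m, f (shift 0 p.1) = h p.1 := fun p => hsh.extend_apply _ _ p
  let s : Set (Torus n) := Set.range fun p : Ball m => shift 0 p.1
  have hcard : Fintype.card (Torus n) = (Finset.Icc 1 (n ^ 2)).card := by
    simp [ZMod.card, sq]
  have hmaps : Set.MapsTo f s (Finset.Icc 1 (n ^ 2)) := by
    rintro _ ⟨p, rfl⟩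
    rw [hf]
    simpa using hr p
  have hinjOn : Set.InjOn f s := by
    rintro _ ⟨p, rfl⟩ _ ⟨q, rfl⟩ e
    rw [hf, hf] at e
    rw [hinj p q e]
  obtain ⟨g, hg⟩ := hmaps.exists_equiv_extend_of_card_eq hcard hinjOn
  refine ⟨fun v => g v, ⟨fun u v e => g.injective (Subtype.ext e), fun v => ?_⟩, fun p => ?_⟩
  · have := Finset.mem_Icc.1 (g v).2
    exact ⟨this.1, this.2.trans hM⟩
  · exact (hg _ ⟨p, rfl⟩).trans (hf p)

/-- An algorithm that works on the `n × n` torus produces allowed neighbourhoods whenever it is fed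
with identifiers that are unique within the radius it inspects, wherever they come from. -/
theorem LocalAlgorithm.SolvesOn.mem_allowed {A : LocalAlgorithm X} {P : LCL X} {N : ℕ → ℕ}
    (hA : A.SolvesOn P N n) (hN : n ^ 2 ≤ N n) (hn : 2 * (P.r + A.time n) < n) {h : ℤ × ℤ → ℕ}
    (hinj : ∀ p q : Ball (P.r + A.time n), h p.1 = h q.1 → p = q)
    (hr : ∀ p : Ball (P.r + A.time n), h p.1 ∈ Set.Icc 1 (n ^ 2)) :
    (fun p : Ball P.r => A.out n fun q : Ball (A.time n) => h (p.1 + q.1)) ∈ P.allowed := by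
  obtain ⟨ident, hid, hident⟩ := exists_identAssignment hn hN hinj hr
  convert hA ident hid 0 using 1
  funext p
  simp only [view, LocalAlgorithm.run]
  congr 1
  funext q
  rw [view, shift_shift]
  exact (hident ⟨p.1 + q.1, ball_add p q⟩).symm

end Simulation

/-! ### Speed-up and normal form -/

section SpeedUp

variable {X : Type*}

/-- The code of an offset in the ball of radius `k` by a number in `{1, …, n ^ 2}`, for
`2 * k < n`. -/
def offsetCode (n k : ℕ) (p : ℤ × ℤ) : ℕ := (p.1 + k).toNat * n + (p.2 + k).toNat + 1

theorem mul_add_inj {n a b c d : ℕ} (hb : b < n) (hd : d < n) (h : a * n + b = c * n + d) :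
    a = c ∧ b = d := by
  have hb' := Nat.mod_eq_of_lt hb
  have hd' := Nat.mod_eq_of_lt hd
  have h1 : b = d := by
    have := congrArg (· % n) h
    simpa [Nat.add_mod, Nat.mul_mod, hb', hd'] using this
  subst h1
  exact ⟨Nat.eq_of_mul_eq_mul_right (by omega : 0 < n) (by omega), rfl⟩

theorem mul_add_lt {n a b : ℕ} (ha : a < n) (hb : b < n) : a * n + b + 1 ≤ n ^ 2 := by
  have : (a + 1) * n ≤ n * n := Nat.mul_le_mul_right n ha
  rw [sq]
  linarith [add_one_mul a n]

theorem ball_bounds {t : ℕ} (p : Ball t) :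
    (-(t : ℤ) ≤ p.1.1 ∧ p.1.1 ≤ t) ∧ (-(t : ℤ) ≤ p.1.2 ∧ p.1.2 ≤ t) := by
  have h := p.2
  have h1 := abs_nonneg p.1.1
  have h2 := abs_nonneg p.1.2
  exact ⟨abs_le.1 (by linarith), abs_le.1 (by linarith)⟩

theorem offsetCode_injective {n k : ℕ} (hk : 2 * k < n) :
    Function.Injective fun p : Ball k => offsetCode n k p.1 := by
  intro p q h
  have hp := ball_bounds p
  have hq := ball_bounds q
  obtain ⟨h1, h2⟩ := mul_add_inj (by omega) (by omega) (Nat.succ_injective h)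
  exact Subtype.ext (Prod.ext (by omega) (by omega))

theorem offsetCode_mem {n k : ℕ} (hk : 2 * k < n) (p : Ball k) :
    offsetCode n k p.1 ∈ Set.Icc 1 (n ^ 2) := by
  have hp := ball_bounds p
  exact ⟨Nat.le_add_left _ _, mul_add_lt (by omega) (by omega)⟩

/-- If some algorithm solves `P` on one sufficiently large `n × n` torus in less than `n / 8`
rounds, then `P` has the normal form. The offset from a node to an anchor within distance `k`
serves as its identifier: nodes with equal offsets to different anchors are more than `k` apart. -/
theorem exists_normalForm {P : LCL X} {N : ℕ → ℕ} {A : LocalAlgorithm X} {n : ℕ}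
    (hA : A.SolvesOn P N n) (hN : n ^ 2 ≤ N n) (ht : 8 * A.time n < n) (hr : 8 * P.r + 16 ≤ n) :
    ∃ k R : ℕ, 1 ≤ k ∧ R ≤ 2 * k ∧ ∃ A' : (Ball R → Bool) → X,
      ∀ᶠ n in atTop, ∀ I : Torus n → Bool, IsAnchorSet n k I →
        P.Feasible fun v => A' (view R I v) := by
  obtain ⟨k, hk, hk', hk1⟩ : ∃ k, 2 * k < n ∧ 2 * (P.r + A.time n) ≤ k ∧ 1 ≤ k :=
    ⟨(n - 1) / 2, by omega, by omega, by omega⟩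
  have hchoice : ∀ w : Ball k → Bool, ∃ p : Ball k, (∃ q, w q = true) → w p = true := fun w => by
    by_cases h : ∃ q, w q = true
    · exact ⟨h.choose, fun _ => h.choose_spec⟩
    · exact ⟨⟨0, by simp⟩, fun h' => absurd h' h⟩
  -- The offset depends only on the radius-`k` view, so `A'` can recompute it.
  choose offset hoffset using hchoice
  refine ⟨k, A.time n + k, hk1, by omega,
    fun w => A.out n fun q => offsetCode n k (offset fun p => w ⟨q.1 + p.1, ball_add q p⟩).1, ?_⟩
  filter_upwards [eventually_gt_atTop k] with n' hn' I hI v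
  have key := hA.mem_allowed hN (by omega)
    (h := fun s => offsetCode n k (offset (view k I (shift v s))).1) ?_
    fun p => offsetCode_mem hk _
  · convert key using 1
    funext p
    change (A.out n fun q => offsetCode n k
        (offset fun p' => I (shift (shift v p.1) (q.1 + p'.1))).1) = A.out n fun q =>
      offsetCode n k (offset fun p' => I (shift (shift v (p.1 + q.1)) p'.1)).1
    simp only [shift_shift, add_assoc]
  · -- Equal offsets `p` from `s` and `s'` lead to two anchors at distance at most `k`.
    intro s s' e
    have e : offset (view k I (shift v s.1)) = offset (view k I (shift v s'.1)) :=
      offsetCode_injective hk e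
    set p := offset (view k I (shift v s.1))
    have h1 : I (shift (shift v s.1) p.1) = true := hoffset _ (hI.exists_anchor (shift v s.1))
    have h2 : I (shift (shift v s'.1) p.1) = true := by
      rw [e]
      exact hoffset _ (hI.exists_anchor (shift v s'.1))
    rw [shift_shift] at h1 h2
    have hs : |(s'.1 - s.1).1| + |(s'.1 - s.1).2| ≤ (k : ℤ) :=
      (ball_sub s'.2 s.2).trans (by push_cast; omega)
    have h3 : shift v (s'.1 + p.1) = shift (shift v (s.1 + p.1)) (s'.1 - s.1) := by
      rw [shift_shift]; congr 1; abel
    have h4 := hI.eq_of_shift (p := ⟨_, hs⟩) h1 (by rw [← h3]; exact h2)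
    rw [← h3] at h4
    refine Subtype.ext (add_right_cancel (shift_left_injective ?_ h4.symm)).symm
    rw [add_sub_add_right_eq_sub]
    exact hs.trans_lt (by exact_mod_cast hn')

theorem LocalAlgorithm.timeBigO_postcomp {Y : Type*} {S : LocalAlgorithm Y} {R : ℕ}
    (F : (Ball R → Y) → X) (hS : S.TimeBigO fun n => (logStar n : ℝ)) :
    (LocalAlgorithm.postcomp F S).TimeBigO fun n => (logStar n : ℝ) := by
  have h1 : (fun _ : ℕ => (R : ℝ)) =O[atTop] fun n => (logStar n : ℝ) := by
    refine IsBigO.of_bound R ?_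
    filter_upwards [tendsto_logStar.eventually_ge_atTop 1] with n hn
    have : (1 : ℝ) ≤ logStar n := by exact_mod_cast hn
    rw [Real.norm_of_nonneg (Nat.cast_nonneg _), Real.norm_of_nonneg (Nat.cast_nonneg _)]
    exact le_mul_of_one_le_right (Nat.cast_nonneg _) this
  refine (h1.add hS).congr_left fun n => ?_
  simp [LocalAlgorithm.postcomp]

end SpeedUp

/-! ### Global algorithms -/

/-- A problem is solved in `2 * n` rounds whenever it is solvable: a node sees the whole torus, and
outputs its label in a fixed feasible labelling, placed with its origin at the node with the least
identifier. -/
theorem exists_global_algorithm {X : Type*} [Nonempty X] (P : LCL X) (N : ℕ → ℕ) :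
    ∃ A : LocalAlgorithm X, A.TimeBigO (fun n => (n : ℝ)) ∧
      ∀ᶠ n in atTop, (∃ f : Torus n → X, P.Feasible f) → A.SolvesOn P N n := by
  classical
  have : ∀ t, Nonempty (Ball t) := fun t => ⟨⟨0, by simp⟩⟩
  refine ⟨⟨fun n => 2 * n, fun n w => if h : ∃ f : Torus n → X, P.Feasible f
    then h.choose (shift 0 (-(Function.argmin w).1)) else Classical.arbitrary X⟩, ?_, ?_⟩
  · refine IsBigO.of_bound 2 (Eventually.of_forall fun n => ?_)
    simp
  · filter_upwards [eventually_ge_atTop 1] with n hn h ident hid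
    have : NeZero n := ⟨by omega⟩
    have hreach : ∀ u v : Torus n, ∃ p : Ball (2 * n), u = shift v p.1 := by
      intro u v
      refine ⟨⟨(((u.1 - v.1).val : ℤ), ((u.2 - v.2).val : ℤ)), ?_⟩, ?_⟩
      · have h1 := ZMod.val_lt (u.1 - v.1)
        have h2 := ZMod.val_lt (u.2 - v.2)
        simp only [Nat.abs_cast]
        push_cast
        omega
      · simp [shift]
    set v₀ := Function.argmin ident
    have hmin : ∀ v, shift v (Function.argmin (view (2 * n) ident v)).1 = v₀ := by
      intro v
      refine hid.1 (le_antisymm ?_ (Function.argmin_le _ _))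
      obtain ⟨p, hp⟩ := hreach v₀ v
      rw [hp]
      exact Function.argmin_le (view (2 * n) ident v) p
    intro v
    convert h.choose_spec (v - v₀) using 1
    funext p
    simp only [view, LocalAlgorithm.run]
    rw [dif_pos h]
    refine congrArg h.choose ?_
    have e := shift_neg_eq (hmin (shift v p.1)).symm
    set q := (Function.argmin (view (2 * n) ident (shift v p.1))).1
    simp only [shift, Prod.ext_iff] at e ⊢
    constructor
    · simp only [Prod.fst_zero, Prod.fst_sub]; linear_combination -e.1
    · simp only [Prod.snd_zero, Prod.snd_sub]; linear_combination -e.2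

/-! ### Colourings of increasing sequences -/

/-- The list `l` is an increasing sequence of length `k` with entries below `M`. -/
def IsWindow (M k : ℕ) (l : List ℕ) : Prop :=
  l.Pairwise (· < ·) ∧ (∀ a ∈ l, a < M) ∧ l.length = k

theorem card_set_eq (α : Type*) [Finite α] : Nat.card (Set α) = 2 ^ Nat.card α := by
  have := Fintype.ofFinite α
  simp

/-- Overlapping windows are glued along a nonempty common part. -/
theorem isWindow_append {M i j : ℕ} {p u : List ℕ} {z : ℕ} (hu : u ≠ [])
    (hp : IsWindow M i (p ++ u)) (hz : IsWindow M j (u ++ [z])) :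
    IsWindow M (i + 1) (p ++ (u ++ [z])) := by
  obtain ⟨h1, h2, h3⟩ := hp
  obtain ⟨h4, h5, -⟩ := hz
  rw [List.pairwise_append] at h1
  obtain ⟨a, u', rfl⟩ := List.exists_cons_of_ne_nil hu
  have haz : a < z := (List.pairwise_append.1 h4).2.2 a (by simp) z (by simp)
  refine ⟨List.pairwise_append.2 ⟨h1.1, h4, fun x hx y hy => ?_⟩, fun x hx => ?_, ?_⟩
  · rcases List.mem_append.1 hy with hy | hy
    · exact h1.2.2 x hx y hy
    · rw [List.mem_singleton.1 hy]
      exact (h1.2.2 x hx a (by simp)).trans haz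
  · rcases List.mem_append.1 hx with hx | hx
    · exact h2 x (List.mem_append_left _ hx)
    · exact h5 x hx
  · rw [← List.append_assoc, List.length_append, h3]
    rfl

/-- A window of length at least two is its head followed by its tail, and its last element preceded
by the others. -/
theorem exists_cons_append {k : ℕ} {l : List ℕ} (hl : l.length = k + 2) :
    ∃ a z v u, l = a :: v ∧ l = u ++ [z] ∧ l.tail = v ∧ l.dropLast = u ∧ u ≠ [] := by
  have hne : l ≠ [] := by rintro rfl; simp at hl
  obtain ⟨a, v, h⟩ := List.exists_cons_of_ne_nil hne
  refine ⟨a, l.getLast hne, v, l.dropLast, h, (List.dropLast_append_getLast hne).symm, by simp [h],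
    rfl, fun h0 => ?_⟩
  have := congrArg List.length h0
  simp [hl] at this

/-- Lower bound for the number of colours in a proper colouring of a shift graph, whose vertices are
the increasing sequences of length `k + 1` and whose edges join the two windows of this length in
each increasing sequence of length `k + 2`. Passing from a sequence to the set of colours of its
extensions to the left turns such a colouring into one for sequences that are shorter by one. -/
theorem le_iterate_of_forall_ne (k : ℕ) {Q : Type*} [Finite Q] (F : List ℕ → Q) (M : ℕ)
    (h : ∀ l, IsWindow M (k + 2) l → F l.tail ≠ F l.dropLast) :
    M ≤ (fun x => 2 ^ x)^[k] (Nat.card Q) := by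
  induction k generalizing Q with
  | zero =>
    have hinj : Function.Injective fun a : Fin M => F [(a : ℕ)] :=
      .of_lt_imp_ne fun a b hlt e => h [a, b] ⟨by simpa using hlt, by simp, rfl⟩ e.symm
    simpa using Nat.card_le_card_of_injective _ hinj
  | succ k ih =>
    rw [Function.iterate_succ_apply, ← card_set_eq Q]
    refine ih (fun u => {χ | ∃ a, IsWindow M (k + 2) (a :: u) ∧ F (a :: u) = χ}) fun l hl e => ?_
    obtain ⟨a, z, v, u, h1, h2, hv, hu, hne⟩ := exists_cons_append hl.2.2
    simp only [hv, hu] at e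
    have hmem : F l ∈ {χ | ∃ a, IsWindow M (k + 2) (a :: v) ∧ F (a :: v) = χ} :=
      ⟨a, h1 ▸ hl, by rw [h1]⟩
    rw [e] at hmem
    obtain ⟨b, hb, hb'⟩ := hmem
    have hw : IsWindow M (k + 3) (b :: l) := by
      have := isWindow_append (p := [b]) hne hb (h2 ▸ hl)
      rwa [← h2] at this
    refine h (b :: l) hw ?_
    rw [List.tail_cons, ← hb', h2, ← List.cons_append, List.dropLast_concat]

/-- If `M` is at least a tower of height about `k`, then every colouring of the increasing sequences
of length `k + 2` below `M` has `L` consecutive windows of the same colour in some sequence. To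
reduce this to proper colourings, colour `u` by the possible lengths of monochromatic runs of
windows that end in `u`. -/
theorem exists_monochromatic_windows (k L : ℕ) {Q : Type*} [Finite Q]
    (F : List ℕ → Q) (M : ℕ) (hM : (fun x => 2 ^ x)^[k] ((2 ^ L) ^ Nat.card Q) < M) :
    ∃ χ l, IsWindow M (L + (k + 1)) l ∧ ∀ i < L, F ((l.drop i).take (k + 2)) = χ := by
  by_contra! hcon
  let Run (u : List ℕ) (χ : Q) (ℓ : ℕ) : Prop := ∃ p, IsWindow M (ℓ + (k + 1)) (p ++ u) ∧
    ∀ i < ℓ, F (((p ++ u).drop i).take (k + 2)) = χ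
  let F' : List ℕ → Q → Set (Fin L) := fun u χ => {ℓ | Run u χ ℓ}
  have hcard : Nat.card (Q → Set (Fin L)) = (2 ^ L) ^ Nat.card Q := by
    rw [Nat.card_fun, card_set_eq, Nat.card_fin]
  rw [← hcard] at hM
  refine absurd (le_iterate_of_forall_ne k F' M fun l hl e => ?_) (not_le.2 hM)
  obtain ⟨a, z, v, u, h1, h2, hv, hu, hne⟩ := exists_cons_append hl.2.2
  rw [hv, hu] at e
  have hulen : u.length = k + 1 := by
    have := hl.2.2
    rw [h2, List.length_append, List.length_singleton] at this
    omega
  -- A run that ends in `u` is prolonged by the window `l`, which ends in `v`.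
  have hstep : ∀ ℓ, Run u (F l) ℓ → Run v (F l) (ℓ + 1) := by
    rintro ℓ ⟨p, hp, hpF⟩
    have hassoc : p ++ [a] ++ v = p ++ l := by rw [h1, List.append_assoc]; rfl
    have hplen : p.length = ℓ := by
      have := hp.2.2
      rw [List.length_append] at this
      omega
    refine ⟨p ++ [a], ?_, fun i hi => ?_⟩
    · rw [hassoc, h2, add_right_comm]
      exact isWindow_append hne hp (h2 ▸ hl)
    · rw [hassoc]
      rcases Nat.lt_succ_iff_lt_or_eq.1 hi with hi | rfl
      · rw [← hpF i hi]
        conv_lhs => rw [h2]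
        rw [← List.append_assoc, List.drop_append_of_le_length (by simp; omega),
          List.take_append_of_le_length (by simp; omega)]
      · rw [← hplen, List.drop_left, List.take_of_length_le hl.2.2.le]
  -- As `u` and `v` have the same colour, the prolongation can be repeated.
  have hrun : ∀ ℓ ≤ L, Run v (F l) ℓ := by
    intro ℓ
    induction ℓ with
    | zero =>
      intro _
      refine ⟨[], ⟨?_, fun x hx => ?_, ?_⟩, fun i hi => by omega⟩
      · have := hl.1
        rw [h1] at this
        exact (List.pairwise_cons.1 this).2
      · exact hl.2.1 x (by rw [h1]; exact List.mem_cons_of_mem _ hx)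
      · have := hl.2.2
        rw [h1, List.length_cons] at this
        simp only [List.nil_append]
        omega
    | succ ℓ ih =>
      intro hℓ
      refine hstep ℓ ?_
      have : (⟨ℓ, hℓ⟩ : Fin L) ∈ F' v (F l) := ih (by omega)
      rw [e] at this
      exact this
  obtain ⟨p, hp, hpF⟩ := hrun L le_rfl
  obtain ⟨i, hi, hiF⟩ := hcon (F l) _ hp
  exact hiF (hpF i hi)

/-! ### The logarithmic lower bound -/

section LowerBound

variable {X : Type*}

theorem IsWindow.exists_ofFn {m k : ℕ} {w : List ℕ} (hw : IsWindow m k w) :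
    ∃ w' : Fin k → Fin m, List.ofFn (fun i => (w' i : ℕ)) = w := by
  obtain ⟨-, h2, rfl⟩ := hw
  exact ⟨fun i => ⟨w[i], h2 _ (List.getElem_mem _)⟩, by simp⟩

theorem IsWindow.drop_take {M j : ℕ} {l : List ℕ} (hl : IsWindow M j l) {i k : ℕ}
    (h : i + k ≤ j) : IsWindow M k ((l.drop i).take k) := by
  refine ⟨(hl.1.sublist (List.drop_sublist _ _)).sublist (List.take_sublist _ _),
    fun a ha => hl.2.1 a (List.mem_of_mem_drop (List.mem_of_mem_take ha)), ?_⟩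
  rw [List.length_take, List.length_drop, hl.2.2]
  omega

theorem IsWindow.getD_lt {M j : ℕ} {l : List ℕ} (hl : IsWindow M j l) {i : ℕ} (hi : i < j) :
    l.getD i 0 < M := by
  rw [List.getD_eq_getElem _ _ (by rw [hl.2.2]; exact hi)]
  exact hl.2.1 _ (List.getElem_mem _)

theorem IsWindow.getD_inj {M j : ℕ} {l : List ℕ} (hl : IsWindow M j l) {a b : ℕ} (ha : a < j)
    (hb : b < j) (h : l.getD a 0 = l.getD b 0) : a = b := by
  rw [List.getD_eq_getElem _ _ (by rw [hl.2.2]; exact ha),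
    List.getD_eq_getElem _ _ (by rw [hl.2.2]; exact hb)] at h
  exact (List.Nodup.getElem_inj_iff (hl.1.imp fun h => h.ne)).1 h

theorem getD_drop_take (l : List ℕ) {i j k : ℕ} (hj : j < k) :
    ((l.drop i).take k).getD j 0 = l.getD (i + j) 0 := by
  simp [List.getD_eq_getElem?_getD, hj]

/-- The two-dimensional version: a colour that depends on one window below `M` and another one below
`m` is constant on the products of `L` consecutive windows with `L` consecutive windows. -/
theorem exists_monochromatic_window_pairs [Finite X] (k L m M : ℕ) (hL : 0 < L)
    (G : List ℕ → List ℕ → X) (hm : (fun x => 2 ^ x)^[k] ((2 ^ L) ^ Nat.card X) < m)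
    (hM : (fun x => 2 ^ x)^[k] ((2 ^ L) ^ (Nat.card X ^ m ^ (k + 2))) < M) :
    ∃ χ l₁ l₂, IsWindow M (L + (k + 1)) l₁ ∧ IsWindow m (L + (k + 1)) l₂ ∧ ∀ i < L, ∀ j < L,
      G ((l₁.drop i).take (k + 2)) ((l₂.drop j).take (k + 2)) = χ := by
  have hcard : Nat.card ((Fin (k + 2) → Fin m) → X) = Nat.card X ^ m ^ (k + 2) := by
    rw [Nat.card_fun, Nat.card_fun, Nat.card_fin, Nat.card_fin]
  rw [← hcard] at hM
  -- The first windows are coloured by functions of the second ones, which explains the tower in `m`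
  -- inside the bound for `M`.
  obtain ⟨χ₁, l₁, hl₁, h₁⟩ := exists_monochromatic_windows k L
    (fun u (w : Fin (k + 2) → Fin m) => G u (List.ofFn fun i => (w i : ℕ))) M hM
  obtain ⟨χ, l₂, hl₂, h₂⟩ := exists_monochromatic_windows k L
    (fun w => G ((l₁.drop 0).take (k + 2)) w) m hm
  refine ⟨χ, l₁, l₂, hl₁, hl₂, fun i hi j hj => ?_⟩
  rw [← h₂ j hj]
  obtain ⟨w, hw⟩ := (hl₂.drop_take (i := j) (k := k + 2) (by omega)).exists_ofFn
  rw [← hw]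
  exact congrFun ((h₁ i hi).trans (h₁ 0 hL).symm) w

/-- If no constant labelling is feasible, then a time-`t` algorithm works only for sizes below a
tower of height `4 * t + O(1)`. Around the origin, the node in column `i` and row `j` gets the
identifier `n * c i + d j + 1` for increasing sequences `c` and `d`, so that its output depends
on a window of `c` and a window of `d`; on larger tori these could be chosen such that the outputs
near the origin agree. -/
theorem exists_logStar_le [Finite X] {P : LCL X} (hP : ∀ x, (fun _ => x) ∉ P.allowed)
    {N : ℕ → ℕ} (hN : ∀ n, n ^ 2 ≤ N n) :
    ∃ B, ∀ n (A : LocalAlgorithm X), A.SolvesOn P N n → logStar n ≤ 4 * A.time n + B := by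
  set r := P.r
  set L := 2 * r + 1
  set q := Nat.card X
  obtain ⟨c, hc₁, hc₂, hc₃⟩ : ∃ c, (2 ^ L) ^ q ≤ c ∧ q ≤ c ∧ 2 ^ L ≤ c :=
    ⟨max ((2 ^ L) ^ q) (max q (2 ^ L)), by simp, by simp, by simp⟩
  refine ⟨c + 2 * r + 12, fun n A hA => logStar_le_of_le_tower ?_⟩
  by_contra! hn
  set t := A.time n
  set m := (fun x => 2 ^ x)^[2 * t] ((2 ^ L) ^ q) + 1
  have hm : m ≤ tower (c + 2 * t + 2) := by
    refine (Nat.succ_le_of_lt ((iterate_two_pow_le (a := c + 1) ?_).trans_lt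
      (tower_lt_succ _))).trans (tower_mono (by omega))
    exact hc₁.trans ((lt_tower c).le.trans (tower_lt_succ c).le)
  have hM : (fun x => 2 ^ x)^[2 * t] ((2 ^ L) ^ (q ^ m ^ (2 * t + 2))) < n := by
    refine lt_of_le_of_lt ?_ hn
    have h1 := pow_le_tower hm (((lt_tower (2 * t + 2)).le).trans
      (tower_mono (show 2 * t + 2 ≤ c + 2 * t + 2 by omega)))
    have h2 := pow_le_tower ((lt_tower q).le.trans (tower_mono
      (by omega : q ≤ c + 2 * t + 2 + 3))) h1
    have h3 := pow_le_tower ((lt_tower (2 ^ L)).le.trans (tower_mono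
      (hc₃.trans (by omega) : 2 ^ L ≤ c + 2 * t + 2 + 3 + 3))) h2
    exact (iterate_two_pow_le h3).trans (tower_mono (by omega))
  have hmn : m ≤ n := (hm.trans (tower_mono (by omega))).trans hn.le
  have hsize : 2 * (r + t) < n := lt_of_le_of_lt (by omega) ((lt_tower _).trans hn)
  obtain ⟨χ, l₁, l₂, hl₁, hl₂, h⟩ := exists_monochromatic_window_pairs (2 * t) L m n
    (Nat.succ_pos _) (fun u w => A.out n fun s : Ball t =>
      u.getD (s.1.1 + t).toNat 0 * n + w.getD (s.1.2 + t).toNat 0 + 1) (Nat.lt_succ_self _) hM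
  have key := hA.mem_allowed (hN n) hsize
    (h := fun s =>
      l₁.getD (s.1 + (r + t : ℕ)).toNat 0 * n + l₂.getD (s.2 + (r + t : ℕ)).toNat 0 + 1)
    (fun p p' e => ?_) fun p => ?_
  · refine hP χ ?_
    convert key using 1
    funext p
    have hp := ball_bounds p
    rw [← h (p.1.1 + r).toNat (by omega) (p.1.2 + r).toNat (by omega)]
    congr 1
    funext s
    have hs := ball_bounds s
    rw [getD_drop_take _ (by omega), getD_drop_take _ (by omega)]
    congr 4
    · simp only [Prod.fst_add]; omega
    · simp only [Prod.snd_add]; omega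
  · have hp := ball_bounds p
    have hp' := ball_bounds p'
    obtain ⟨e1, e2⟩ := mul_add_inj ((hl₂.getD_lt (by omega)).trans_le hmn)
      ((hl₂.getD_lt (by omega)).trans_le hmn) (Nat.succ_injective e)
    have e1 := hl₁.getD_inj (by omega) (by omega) e1
    have e2 := hl₂.getD_inj (by omega) (by omega) e2
    exact Subtype.ext (Prod.ext (by omega) (by omega))
  · have hp := ball_bounds p
    exact ⟨Nat.le_add_left _ _, mul_add_lt (hl₁.getD_lt (by omega))
      ((hl₂.getD_lt (by omega)).trans_le hmn)⟩

theorem complexityOmega_logStar [Finite X] {P : LCL X} (hP : ∀ x, (fun _ => x) ∉ P.allowed)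
    {N : ℕ → ℕ} (hN : ∀ n, n ^ 2 ≤ N n) : P.ComplexityOmega N fun n => (logStar n : ℝ) := by
  obtain ⟨B, hB⟩ := exists_logStar_le hP hN
  refine ⟨1 / 8, by norm_num, ?_⟩
  filter_upwards [tendsto_logStar.eventually_ge_atTop (2 * B)] with n hn A hA
  have h1 : (logStar n : ℝ) ≤ 4 * A.time n + B := by exact_mod_cast hB n A hA
  have h2 : (2 * B : ℝ) ≤ logStar n := by exact_mod_cast hn
  linarith

end LowerBound

/-! ### Classification -/

theorem isTrivial_of_const {X : Type*} {P : LCL X} (N : ℕ → ℕ) {x : X}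
    (hx : (fun _ => x) ∈ P.allowed) : P.IsTrivial N :=
  ⟨⟨fun _ => 0, fun _ _ => x⟩, Eventually.of_forall fun _ _ _ _ => hx,
    IsBigO.of_bound 1 (Eventually.of_forall fun n => by simp)⟩

end GridLCL

theorem theorem5p1 :
    ∃ C : ℕ, ∀ N : ℕ → ℕ, IsIdRange N →
      -- the problem-independent components `S k`
      ∃ S : ℕ → LocalAlgorithm Bool,
        (∀ k, (S k).TimeBigO (fun n => (logStar n : ℝ)) ∧
          ∀ᶠ n in atTop, ∀ ident : Torus n → ℕ, IsIdAssignment (N n) ident →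
            IsAnchorSet n k ((S k).run ident)) ∧
        ∀ (X : Type*) [Finite X] [Nonempty X] (P : LCL X),
          -- speed-up and normal form
          ((∃ A : LocalAlgorithm X, A.Solves P N ∧ A.TimeLittleO (fun n => (n : ℝ))) →
            ∃ k R : ℕ, 1 ≤ k ∧ R ≤ C * k ∧ ∃ A' : (Ball R → Bool) → X,
              (∀ᶠ n in atTop, ∀ I : Torus n → Bool, IsAnchorSet n k I →
                P.Feasible (fun v => A' (view R I v))) ∧
              ∃ B : LocalAlgorithm X, B = LocalAlgorithm.postcomp A' (S k) ∧
                B.Solves P N ∧ B.TimeBigO (fun n => (logStar n : ℝ))) ∧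
          -- classification
          (P.IsTrivial N ∨ P.IsLocal N ∨ P.IsGlobal N) := by
  refine ⟨2, fun N hN => ?_⟩
  choose S hS using fun k => exists_anchor_algorithm hN k
  refine ⟨S, hS, fun X _ _ P => ?_⟩
  -- One good torus suffices for the normal form, which serves both parts of the theorem.
  have normalForm : ∀ (n : ℕ) (A : LocalAlgorithm X), A.SolvesOn P N n → 8 * A.time n < n →
      8 * P.r + 16 ≤ n → ∃ k R : ℕ, 1 ≤ k ∧ R ≤ 2 * k ∧ ∃ A' : (Ball R → Bool) → X,
        (∀ᶠ n in atTop, ∀ I : Torus n → Bool, IsAnchorSet n k I →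
          P.Feasible (fun v => A' (view R I v))) ∧
        ∃ B : LocalAlgorithm X, B = LocalAlgorithm.postcomp A' (S k) ∧
          B.Solves P N ∧ B.TimeBigO (fun n => (logStar n : ℝ)) := by
    intro n A hA ht hr
    obtain ⟨k, R, hk, hR, A', hA'⟩ := exists_normalForm hA (hN.1 n) ht hr
    refine ⟨k, R, hk, hR, A', hA', _, rfl, ?_, LocalAlgorithm.timeBigO_postcomp A' (hS k).1⟩
    filter_upwards [hA', (hS k).2] with n h1 h2 ident hid
    rw [funext fun v => LocalAlgorithm.run_postcomp A' (S k) ident v]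
    exact h1 _ (h2 ident hid)
  constructor
  · rintro ⟨A, hA, hT⟩
    obtain ⟨n, hn, hn', hn''⟩ := (hA.and ((hT.bound (show (0 : ℝ) < 1 / 16 by norm_num)).and
      (eventually_ge_atTop (8 * P.r + 16)))).exists
    refine normalForm n A hn ?_ hn''
    rw [Real.norm_of_nonneg (Nat.cast_nonneg _), Real.norm_of_nonneg (Nat.cast_nonneg _)] at hn'
    have h1 : (0 : ℝ) < n := by exact_mod_cast (show 0 < n by omega)
    have : (8 * A.time n : ℝ) < n := by linarith
    exact_mod_cast this
  · by_cases hconst : ∃ x, (fun _ => x) ∈ P.allowed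
    · obtain ⟨x, hx⟩ := hconst
      exact Or.inl (isTrivial_of_const N hx)
    · refine Or.inr ?_
      by_cases hΩ : P.ComplexityOmega N fun n => (n : ℝ)
      · exact Or.inr ⟨exists_global_algorithm P N, hΩ⟩
      · refine Or.inl ⟨?_, complexityOmega_logStar (not_exists.1 hconst) hN.1⟩
        -- The bound `n / 8` fails for arbitrarily large `n`, with an algorithm for each of them.
        have hfreq : ∃ᶠ n in atTop, ∃ A : LocalAlgorithm X,
            A.SolvesOn P N n ∧ 8 * A.time n < n := by
          intro h
          refine hΩ ⟨1 / 8, by norm_num, h.mono fun n hn A hA => ?_⟩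
          by_contra hlt
          refine hn ⟨A, hA, ?_⟩
          have : (8 * A.time n : ℝ) < n := by linarith
          exact_mod_cast this
        obtain ⟨n, ⟨A, hA, ht⟩, hn⟩ := (hfreq.and_eventually
          (eventually_ge_atTop (8 * P.r + 16))).exists
        obtain ⟨k, R, -, -, A', -, B, -, hB, hB'⟩ := normalForm n A hA ht hn
        exact ⟨B, hB, hB'⟩
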